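/- Let $A\in\mathbb{R}^{n\times n}$ be symmetric positive definite, let $V\in\mathbb{R}^{n\times m}$ have rank $m$, let $W=V$, and let the columns of $Y$ satisfy $\mathrm{Range}(Y)=\mathrm{Null}(W^TA)$ and $Y^TAY=I$ (so $Y$ has $n-m$ columns). Let $x_0\in\mathbb{R}^n$, $\alpha,\beta>0$, $k\ge 0$, put $P_1=I-V(W^TAV)^{-1}W^TA$ and, for $b\in\mathbb{R}^n$, $\widetilde x=\widetilde x(b)=x_0+V(W^TAV)^{-1}W^T(b-Ax_0)$. Let $s$ have the inverse-gamma distribution $\mathsf{IG}(\alpha,\beta)$, with density $\frac{\beta^\alpha}{\Gamma(\alpha)}s^{-(\alpha+1)}e^{-\beta/s}$ on $s>0$. Suppose that, conditionally on $s$, the random vectors $x,Z_{\star 1},\dots,Z_{\star k}$ in $\mathbb{R}^n$ are independent, $x$ is normal with mean $x_0$ and covariance $\Sigma_0=VV^T+sYY^T$ (that is, $VV^T+YGY^T$ with $G=sI$), and each $Z_{\star i}$ is distributed as $A^{1/2}P_1(x-x_0)$. Let $Z$ be the $n\times k$ matrix with columns $Z_{\star i}$. Put $\widetilde\alpha=\alpha+k(n-m)/2$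 and $\widetilde\beta=\beta+\mathrm{tr}(Z^TZ)/2$. Then: 1. The posterior distribution of $s$ given $Z$ is $\mathsf{IG}(\widetilde\alpha,\widetilde\beta)$. 2. For every $b\in\mathbb{R}^n$, the predictive distribution of $x$ given $W^TAx=W^Tb$ and $Z$ is the multivariate Student distribution $\mathsf{St}_{2\widetilde\alpha}\left(\widetilde x,\frac{\widetilde\beta}{\widetilde\alpha}YY^T\right)$. Here, for a positive semidefinite matrix $\Sigma$ of rank $r$ with Moore--Penrose inverse $\Sigma^\dagger$ and product of nonzero eigenvalues $\det D$, $\mathsf{St}_\nu(\mu,\Sigma)$ is the distribution on the affine subspace $\mu+\mathrm{Range}(\Sigma)$ whose density with respect to $r$-dimensional Lebesgue measure is $$\frac{\Gamma\left(\frac{\nu+r}{2}\right)}{\Gamma\left(\frac{\nu}{2}\right)\sqrt{(\pi\nu)^r\det D}}\left(1+\frac1\nu(x-\mu)^T\Sigma^\dagger(x-\mu)\right)^{-\frac{\nu+r}{2}}.$$ The conditional distributions are regular conditional distributions, in the version that depends continuously (for weak convergence) on the conditioning value ($Z$ in part 1, $(W^TAx,Z)$ in part 2). -/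

import Mathlib

open MeasureTheory ProbabilityTheory Matrix
open scoped MatrixOrder BoundedContinuousFunction

/-! ### Distributions -/

/-- Density of the inverse-gamma distribution with shape `α` and scale `β`. -/
noncomputable def invGammaPDFReal (α β t : ℝ) : ℝ :=
  if 0 < t then β ^ α / Real.Gamma α * t ^ (-(α + 1)) * Real.exp (-(β / t)) else 0

/-- The inverse-gamma distribution with shape `α` and scale `β` (for `0 < α`, `0 < β`). -/
noncomputable def invGammaMeasure (α β : ℝ) : Measure ℝ :=
  volume.withDensity (fun t => ENNReal.ofReal (invGammaPDFReal α β t))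

/-- The Moore-Penrose inverse of a symmetric matrix: with `S = U D Uᵀ`, `U` orthogonal and `D`
diagonal, it is `U D' Uᵀ`, where `D'` inverts the nonzero entries of `D` and keeps the zero ones
(recall `0⁻¹ = 0`). -/
noncomputable def symmPinv {n : ℕ} (S : Matrix (Fin n) (Fin n) ℝ) : Matrix (Fin n) (Fin n) ℝ :=
  cfc (fun t : ℝ => t⁻¹) S

/-- The product of the nonzero eigenvalues, with multiplicity, of a symmetric matrix. -/
noncomputable def pseudoDet {n : ℕ} (S : Matrix (Fin n) (Fin n) ℝ) : ℝ :=
  (S.charpoly.roots.filter (fun t => t ≠ 0)).prod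

/-- The Lebesgue measure, of dimension `finrank R`, of the affine subspace `μ + R` of `ℝⁿ`. -/
noncomputable def affineVolume {n : ℕ} (μ : EuclideanSpace ℝ (Fin n))
    (R : Submodule ℝ (EuclideanSpace ℝ (Fin n))) : Measure (EuclideanSpace ℝ (Fin n)) :=
  ((stdOrthonormalBasis ℝ R).toBasis.addHaar).map (fun r : R => μ + (r : EuclideanSpace ℝ (Fin n)))

/-- Density, on the affine subspace `μ + range S`, of the multivariate Student distribution with `ν`
degrees of freedom, location `μ` and positive semidefinite, possibly singular, scale matrix `S`. -/
noncomputable def studentPDFReal {n : ℕ} (ν : ℝ) (μ : EuclideanSpace ℝ (Fin n))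
    (S : Matrix (Fin n) (Fin n) ℝ) (x : EuclideanSpace ℝ (Fin n)) : ℝ :=
  Real.Gamma ((ν + S.rank) / 2) /
      (Real.Gamma (ν / 2) * Real.sqrt ((Real.pi * ν) ^ S.rank * pseudoDet S)) /
    (1 + 1 / ν * ((x - μ).ofLp ⬝ᵥ symmPinv S *ᵥ (x - μ).ofLp)) ^ ((ν + S.rank) / 2)

/-- The multivariate Student distribution `St_ν(μ, S)`. -/
noncomputable def studentMeasure {n : ℕ} (ν : ℝ) (μ : EuclideanSpace ℝ (Fin n))
    (S : Matrix (Fin n) (Fin n) ℝ) : Measure (EuclideanSpace ℝ (Fin n)) :=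
  (affineVolume μ (LinearMap.range (Matrix.toEuclideanLin S))).withDensity
    (fun x => ENNReal.ofReal (studentPDFReal ν μ S x))

/-! ### Conditional distributions -/

/-- `κ` is the conditional distribution of `Y` given `X`, in the version that depends continuously
(for weak convergence) on the value of `X`. Continuity gives a meaning to conditioning on `X = a`
for an individual `a` in the support of the law of `X`, even if `X = a` has probability zero. -/
def IsContCondDistrib {Ω 𝓧 𝓨 : Type*} [MeasurableSpace Ω]
    [TopologicalSpace 𝓧] [MeasurableSpace 𝓧]
    [TopologicalSpace 𝓨] [MeasurableSpace 𝓨] [StandardBorelSpace 𝓨] [Nonempty 𝓨]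
    (Y : Ω → 𝓨) (X : Ω → 𝓧) (P : Measure Ω) [IsFiniteMeasure P] (κ : 𝓧 → Measure 𝓨) : Prop :=
  (∀ a, IsProbabilityMeasure (κ a)) ∧
  (∀ f : 𝓨 →ᵇ ℝ, Continuous fun a => ∫ y, f y ∂(κ a)) ∧
  ∀ᵐ a ∂(P.map X), condDistrib Y X P a = κ a

/-! ### Projection methods -/

/-- The approximation `x₀ + V (Wᵀ A V)⁻¹ Wᵀ (b - A x₀)` of the projection method. -/
noncomputable def projApprox {n m : ℕ} (A : Matrix (Fin n) (Fin n) ℝ)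
    (V W : Matrix (Fin n) (Fin m) ℝ) (x₀ b : EuclideanSpace ℝ (Fin n)) :
    EuclideanSpace ℝ (Fin n) :=
  x₀ + WithLp.toLp 2 ((V * (Wᵀ * A * V)⁻¹ * Wᵀ) *ᵥ (b.ofLp - A *ᵥ x₀.ofLp))

/-- The projector `P₁ = I - V (Wᵀ A V)⁻¹ Wᵀ A`. -/
noncomputable def errorProj {n m : ℕ} (A : Matrix (Fin n) (Fin n) ℝ)
    (V W : Matrix (Fin n) (Fin m) ℝ) : Matrix (Fin n) (Fin n) ℝ :=
  1 - V * (Wᵀ * A * V)⁻¹ * Wᵀ * A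

/-- The normal distribution with mean `x₀` and covariance matrix `V Vᵀ + Y G Yᵀ`. -/
noncomputable def projPrior {n m p : ℕ} (x₀ : EuclideanSpace ℝ (Fin n))
    (V : Matrix (Fin n) (Fin m) ℝ) (Y : Matrix (Fin n) (Fin p) ℝ)
    (G : Matrix (Fin p) (Fin p) ℝ) : Measure (EuclideanSpace ℝ (Fin n)) :=
  multivariateGaussian x₀ (V * Vᵀ + Y * G * Yᵀ)

/-- The map `x ↦ A^{1/2} P₁ (x - x₀)`. -/
noncomputable def scaledError {n m : ℕ} (A : Matrix (Fin n) (Fin n) ℝ)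
    (V W : Matrix (Fin n) (Fin m) ℝ) (x₀ x : EuclideanSpace ℝ (Fin n)) :
    EuclideanSpace ℝ (Fin n) :=
  WithLp.toLp 2 ((CFC.sqrt A * errorProj A V W) *ᵥ (x - x₀).ofLp)

/-- The matrix with columns `z 0, …, z (k - 1)`. -/
def colMatrix {n k : ℕ} (z : Fin k → EuclideanSpace ℝ (Fin n)) : Matrix (Fin n) (Fin k) ℝ :=
  Matrix.of fun i j => z j i

/-- The updated shape `α + k (n - m) / 2`. -/
noncomputable def postShape (α : ℝ) (n m k : ℕ) : ℝ := α + k * ((n : ℝ) - m) / 2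

/-- The updated scale `β + tr (Zᵀ Z) / 2`. -/
noncomputable def postScale {n k : ℕ} (β : ℝ) (Z : Matrix (Fin n) (Fin k) ℝ) : ℝ :=
  β + (Zᵀ * Z).trace / 2

/-! ### Product densities -/

/-! Given `s = t`, the prior reads `x = x₀ + V u + √t Y w` with `u`, `w` independent standard normal
vectors (`multivariateGaussian_eq_map_prod`). Since `W = V`, the projector `P₁` kills `V` and fixes
`Y`, so an observation is `A^{1/2} Y v` with `v = √t w'` and `w'` standard normal. Because `Yᵀ A Y =
1`, it has the same norm as `v`, and `tr (Zᵀ Z)` is the sum of the squared norms of the `v i`.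

Part 1 is thus normal/inverse-gamma conjugacy in dimension `k p`, where `p = n - m` by rank-nullity:
in the joint density of `(s, v)` the powers of `s` add up and the exponents `β / s` and `∑ ‖v i‖² /
(2 s)` merge (`lintegral_invGammaMeasure_gaussian`).

For part 2, `Vᵀ A x = Vᵀ A x₀ + (Vᵀ A V) u` does not involve `w` or `s` and determines `u`, since
`Vᵀ A V` is invertible. Conditionally, `x` is therefore `x̃ + √s Y w` with `s` drawn from its
posterior and `w` still standard normal. Such a mixture is a Student law (`studentMeasure_eq_map`):
the same conjugacy, with the scale integrated out, gives the density in the coordinates of `Y`, and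
the Gram determinant `det (Yᵀ Y)` converts it to Lebesgue measure on the affine subspace.

The continuous version of the conditional laws comes from `IG(a, b) = b · IG(a, 1)`: each is the
image of one fixed law under a map continuous in the conditioning value
(`isContCondDistrib_of_randomization`). -/

theorem pi_withDensity_ofReal {ι : Type*} [Fintype ι] {E : ι → Type*}
    [∀ i, MeasurableSpace (E i)] (μ : ∀ i, Measure (E i)) [∀ i, SigmaFinite (μ i)]
    (f : ∀ i, E i → ℝ) (hf : ∀ i x, 0 ≤ f i x)
    (hfi : ∀ i, Integrable (f i) (μ i)) :
    Measure.pi (fun i => (μ i).withDensity (fun x => ENNReal.ofReal (f i x))) =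
      (Measure.pi μ).withDensity (fun x => ENNReal.ofReal (∏ i, f i (x i))) := by
  refine Measure.pi_eq fun s hs => ?_
  rw [withDensity_apply _ (MeasurableSet.univ_pi hs), Measure.restrict_pi_pi,
    ← ofReal_integral_eq_lintegral_ofReal, integral_fintype_prod_eq_prod,
    ENNReal.ofReal_prod_of_nonneg]
  · refine Finset.prod_congr rfl fun i _ => ?_
    rw [withDensity_apply _ (hs i), ofReal_integral_eq_lintegral_ofReal]
    · exact (hfi i).restrict
    · exact Filter.Eventually.of_forall (hf i)
  · exact fun i _ => integral_nonneg (hf i)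
  · exact Integrable.fintype_prod_dep fun i => (hfi i).restrict
  · exact Filter.Eventually.of_forall fun x => Finset.prod_nonneg fun i _ => hf i _

/-! ### The inverse-gamma distribution -/

theorem invGammaPDFReal_nonneg {α β : ℝ} (hα : 0 < α) (hβ : 0 < β) (t : ℝ) :
    0 ≤ invGammaPDFReal α β t := by
  unfold invGammaPDFReal
  split_ifs <;> positivity

@[fun_prop]
theorem measurable_uncurry_invGammaPDFReal (α : ℝ) :
    Measurable fun q : ℝ × ℝ => invGammaPDFReal α q.1 q.2 := by
  unfold invGammaPDFReal
  refine Measurable.ite (measurableSet_lt measurable_const measurable_snd) ?_ measurable_const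
  fun_prop

@[fun_prop]
theorem measurable_invGammaPDFReal (α β : ℝ) : Measurable (invGammaPDFReal α β) :=
  (measurable_uncurry_invGammaPDFReal α).comp (measurable_const.prodMk measurable_id)

theorem lintegral_invGammaMeasure (α β : ℝ) {f : ℝ → ENNReal} (hf : Measurable f) :
    ∫⁻ t, f t ∂(invGammaMeasure α β) =
      ∫⁻ t, ENNReal.ofReal (invGammaPDFReal α β t) * f t := by
  rw [invGammaMeasure, lintegral_withDensity_eq_lintegral_mul _ (by fun_prop) hf]
  rfl

theorem ae_pos_invGammaMeasure (α β : ℝ) : ∀ᵐ t ∂(invGammaMeasure α β), 0 < t := by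
  rw [invGammaMeasure, ae_withDensity_iff (by fun_prop)]
  refine Filter.Eventually.of_forall fun t ht => ?_
  by_contra h
  simp [invGammaPDFReal, h] at ht

theorem isProbabilityMeasure_invGammaMeasure {α β : ℝ} (hα : 0 < α) (hβ : 0 < β) :
    IsProbabilityMeasure (invGammaMeasure α β) := by
  have hind : invGammaPDFReal α β = Set.indicator (Set.Ioi 0)
      (fun t => β ^ α / Real.Gamma α * t ^ (-(α + 1)) * Real.exp (-(β / t))) := by
    ext t
    simp [invGammaPDFReal, Set.indicator, Set.mem_Ioi]
  have hint : ∫ t, invGammaPDFReal α β t = 1 := by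
    rw [hind, integral_indicator measurableSet_Ioi]
    -- The substitution `y = t⁻¹` reduces the total mass to the Gamma integral.
    have h1 := integral_comp_rpow_Ioi (fun y : ℝ => y ^ (α - 1) * Real.exp (-(β * y)))
      (p := -1) (by norm_num)
    rw [Real.integral_rpow_mul_exp_neg_mul_Ioi hα hβ] at h1
    have h2 : ∫ t in Set.Ioi (0 : ℝ),
        β ^ α / Real.Gamma α * t ^ (-(α + 1)) * Real.exp (-(β / t)) =
        β ^ α / Real.Gamma α * ∫ t in Set.Ioi (0 : ℝ), (|(-1 : ℝ)| * t ^ ((-1 : ℝ) - 1)) •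
          ((t ^ (-1 : ℝ)) ^ (α - 1) * Real.exp (-(β * t ^ (-1 : ℝ)))) := by
      rw [← integral_const_mul]
      refine setIntegral_congr_fun measurableSet_Ioi fun t (ht : 0 < t) => ?_
      simp only [smul_eq_mul, abs_neg, abs_one, one_mul]
      rw [← Real.rpow_mul ht.le, ← mul_assoc (t ^ _), ← Real.rpow_add ht, Real.rpow_neg_one,
        ← div_eq_mul_inv, mul_assoc]
      ring_nf
    rw [h2, h1, Real.div_rpow zero_le_one hβ.le, Real.one_rpow]
    have := (Real.Gamma_pos_of_pos hα).ne'
    have := (Real.rpow_pos_of_pos hβ α).ne'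
    field_simp
  constructor
  rw [invGammaMeasure, withDensity_apply _ MeasurableSet.univ, Measure.restrict_univ,
    ← ofReal_integral_eq_lintegral_ofReal, hint, ENNReal.ofReal_one]
  · exact Integrable.of_integral_ne_zero (by rw [hint]; exact one_ne_zero)
  · exact Filter.Eventually.of_forall (invGammaPDFReal_nonneg hα hβ)

theorem invGammaMeasure_map_const_mul (α β : ℝ) (hβ : 0 < β) {c : ℝ} (hc : 0 < c) :
    (invGammaMeasure α β).map (fun t => c * t) = invGammaMeasure α (c * β) := by
  refine Measure.ext_of_lintegral _ fun f hf => ?_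
  rw [lintegral_map hf (by fun_prop), lintegral_invGammaMeasure _ _ (by fun_prop),
    lintegral_invGammaMeasure _ _ hf]
  have h1 : ∀ t, ENNReal.ofReal (invGammaPDFReal α β t) * f (c * t) =
      (fun u => ENNReal.ofReal (invGammaPDFReal α β (c⁻¹ * u)) * f u) (c * t) := by
    intro t
    simp [hc.ne']
  have hm : Measurable fun u => ENNReal.ofReal (invGammaPDFReal α β (c⁻¹ * u)) * f u :=
    ((measurable_invGammaPDFReal α β).comp (measurable_const_mul _)).ennreal_ofReal.mul hf
  simp_rw [h1]
  rw [← lintegral_map hm (measurable_const_mul c), Real.map_volume_mul_left hc.ne',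
    lintegral_smul_measure, smul_eq_mul, ← lintegral_const_mul _ hm]
  refine lintegral_congr fun u => ?_
  rw [← mul_assoc, ← ENNReal.ofReal_mul (abs_nonneg _)]
  congr 2
  rw [abs_of_pos (inv_pos.2 hc)]
  by_cases hu : 0 < u
  · have hu' : 0 < c⁻¹ * u := by positivity
    rw [invGammaPDFReal, invGammaPDFReal, if_pos hu, if_pos hu', Real.mul_rpow (by positivity) hu.le,
      Real.mul_rpow hc.le hβ.le, Real.inv_rpow hc.le, Real.rpow_neg hc.le, inv_inv,
      Real.rpow_add hc, Real.rpow_one]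
    have : β / (c⁻¹ * u) = c * β / u := by field_simp
    rw [this]
    field_simp
  · have hu' : ¬ 0 < c⁻¹ * u := by
      intro h
      exact hu (pos_of_mul_pos_right h (inv_pos.2 hc).le)
    rw [invGammaPDFReal, invGammaPDFReal, if_neg hu, if_neg hu', mul_zero]

/-- Moves the dependence on the scale from the measure to the map, which makes continuity in the
data visible. -/
theorem invGammaMeasure_eq_map (α : ℝ) {b : ℝ} (hb : 0 < b) :
    invGammaMeasure α b = (invGammaMeasure α 1).map (fun t => b * t) := by
  rw [invGammaMeasure_map_const_mul α 1 one_pos hb, mul_one]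

/-! ### Normal variance mixtures -/

/-- Density, with respect to Lebesgue measure on a space of dimension `d`, of `√t w` when `t` is
inverse-gamma distributed, `w` is standard normal and `√t w` has squared norm `q`. -/
noncomputable def mixtureDensity (d : ℕ) (α β q : ℝ) : ℝ :=
  (2 * Real.pi) ^ (-(d : ℝ) / 2) * (β ^ α * Real.Gamma (α + d / 2) / Real.Gamma α) *
    (β + q / 2) ^ (-(α + d / 2))

theorem mixtureDensity_nonneg (d : ℕ) {α β q : ℝ} (hα : 0 < α) (hβ : 0 < β) (hq : 0 ≤ q) :
    0 ≤ mixtureDensity d α β q := by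
  unfold mixtureDensity
  have := Real.Gamma_pos_of_pos hα
  have := Real.Gamma_pos_of_pos (show 0 < α + d / 2 by positivity)
  positivity

theorem measurable_mixtureDensity (d : ℕ) (α β : ℝ) : Measurable (mixtureDensity d α β) := by
  unfold mixtureDensity
  fun_prop

/-- Bayes' formula for densities: prior times likelihood is marginal times posterior. -/
theorem invGammaPDFReal_mul_gaussian (d : ℕ) {α β q t : ℝ} (hα : 0 < α) (hβ : 0 < β)
    (hq : 0 ≤ q) (ht : 0 < t) :
    invGammaPDFReal α β t *
      (t ^ (-(d : ℝ) / 2) * ((2 * Real.pi) ^ (-(d : ℝ) / 2) * Real.exp (-(q / t) / 2))) =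
      mixtureDensity d α β q * invGammaPDFReal (α + d / 2) (β + q / 2) t := by
  have h1 : (0 : ℝ) < β + q / 2 := by positivity
  have hG := (Real.Gamma_pos_of_pos hα).ne'
  have hG' := (Real.Gamma_pos_of_pos (show 0 < α + d / 2 by positivity)).ne'
  have h2 := (Real.rpow_pos_of_pos h1 (α + d / 2)).ne'
  rw [invGammaPDFReal, invGammaPDFReal, if_pos ht, if_pos ht, mixtureDensity,
    Real.rpow_neg h1.le]
  have he : Real.exp (-((β + q / 2) / t)) = Real.exp (-(β / t)) * Real.exp (-(q / t) / 2) := by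
    rw [← Real.exp_add]
    congr 1
    field_simp
    ring
  have hp : t ^ (-(α + d / 2 + 1)) = t ^ (-(α + 1)) * t ^ (-(d : ℝ) / 2) := by
    rw [← Real.rpow_add ht]
    congr 1
    ring
  rw [he, hp]
  field_simp

/-- Conjugacy of the inverse-gamma distribution for the variance of a normal vector. -/
theorem lintegral_invGammaMeasure_gaussian {E : Type*} [NormedAddCommGroup E] [NormedSpace ℝ E]
    [MeasurableSpace E] [BorelSpace E] [FiniteDimensional ℝ E] (μ : Measure E)
    [μ.IsAddHaarMeasure] {d : ℕ} (hd : Module.finrank ℝ E = d) {q : E → ℝ} (hqm : Measurable q)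
    (hq0 : ∀ v, 0 ≤ q v) (hq : ∀ (c : ℝ) v, q (c • v) = c ^ 2 * q v) {γ : Measure E}
    (hγ : γ = μ.withDensity fun v =>
      ENNReal.ofReal ((2 * Real.pi) ^ (-(d : ℝ) / 2) * Real.exp (-q v / 2)))
    {α β : ℝ} (hα : 0 < α) (hβ : 0 < β) {F : ℝ → E → ENNReal}
    (hF : Measurable (Function.uncurry F)) :
    ∫⁻ t, ∫⁻ w, F t (√t • w) ∂γ ∂(invGammaMeasure α β) =
      ∫⁻ v, ∫⁻ t, F t v ∂(invGammaMeasure (α + d / 2) (β + q v / 2))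
        ∂(μ.withDensity fun v => ENNReal.ofReal (mixtureDensity d α β (q v))) := by
  have hFt : ∀ t, Measurable (F t) := fun t => hF.comp measurable_prodMk_left
  have hFv : ∀ v, Measurable fun t => F t v := fun v => hF.comp measurable_prodMk_right
  set g : E → ENNReal := fun v =>
    ENNReal.ofReal ((2 * Real.pi) ^ (-(d : ℝ) / 2) * Real.exp (-q v / 2)) with hg
  have hgm : Measurable g := by fun_prop
  have hMm : Measurable fun v => ENNReal.ofReal (mixtureDensity d α β (q v)) :=
    ((measurable_mixtureDensity d α β).comp hqm).ennreal_ofReal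
  have hFs : Measurable fun p : ℝ × E => F p.1 (√p.1 • p.2) :=
    hF.comp (f := fun p : ℝ × E => (p.1, √p.1 • p.2)) (by fun_prop)
  have hG : Measurable fun p : ℝ × E => ENNReal.ofReal (invGammaPDFReal α β p.1 *
      (p.1 ^ (-(d : ℝ) / 2) * ((2 * Real.pi) ^ (-(d : ℝ) / 2) *
        Real.exp (-(q p.2 / p.1) / 2)))) * F p.1 p.2 := by
    have : Measurable fun p : ℝ × E => invGammaPDFReal α β p.1 :=
      (measurable_invGammaPDFReal α β).comp measurable_fst
    refine Measurable.mul (Measurable.ennreal_ofReal (this.mul ?_)) hF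
    fun_prop
  have hinner : ∀ v, ∫⁻ t, F t v ∂(invGammaMeasure (α + d / 2) (β + q v / 2)) =
      ∫⁻ t, ENNReal.ofReal (invGammaPDFReal (α + d / 2) (β + q v / 2) t) * F t v :=
    fun v => lintegral_invGammaMeasure _ _ (hFv v)
  have hIm : Measurable fun v => ∫⁻ t, ENNReal.ofReal
      (invGammaPDFReal (α + d / 2) (β + q v / 2) t) * F t v := by
    refine Measurable.lintegral_prod_right' (f := fun p : E × ℝ => ENNReal.ofReal
      (invGammaPDFReal (α + d / 2) (β + q p.1 / 2) p.2) * F p.2 p.1) ?_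
    refine Measurable.mul ?_ (hF.comp measurable_swap)
    exact ((measurable_uncurry_invGammaPDFReal (α + d / 2)).comp
      (show Measurable fun p : E × ℝ => (β + q p.1 / 2, p.2) by fun_prop)).ennreal_ofReal
  simp_rw [hinner]
  rw [lintegral_withDensity_eq_lintegral_mul _ hMm hIm, hγ, lintegral_invGammaMeasure]
  swap
  · have : SFinite (μ.withDensity g) := inferInstance
    exact hFs.lintegral_prod_right'
  -- Substitute `v = √t • w`: the Jacobian is `t ^ (-d / 2)` and homogeneity gives `q w = q v / t`.
  -- For `t ≤ 0` both sides vanish with the prior density.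
  have hleft : ∀ t, ENNReal.ofReal (invGammaPDFReal α β t) *
      ∫⁻ w, F t (√t • w) ∂(μ.withDensity g) =
      ∫⁻ v, ENNReal.ofReal (invGammaPDFReal α β t *
      (t ^ (-(d : ℝ) / 2) * ((2 * Real.pi) ^ (-(d : ℝ) / 2) *
        Real.exp (-(q v / t) / 2)))) * F t v ∂μ := by
    intro t
    by_cases ht : 0 < t
    swap
    · simp [invGammaPDFReal, ht]
    have hs : 0 < √t := Real.sqrt_pos.2 ht
    rw [lintegral_withDensity_eq_lintegral_mul _ hgm (g := fun w => F t (√t • w))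
      ((hFt t).comp (measurable_const_smul _))]
    set h : E → ENNReal := fun v => ENNReal.ofReal
      ((2 * Real.pi) ^ (-(d : ℝ) / 2) * Real.exp (-(q v / t) / 2)) * F t v with hh
    have hhm : Measurable h := Measurable.mul (by fun_prop) (hFt t)
    have h1 : ∀ w, (g * fun w => F t (√t • w)) w = h (√t • w) := by
      intro w
      simp only [Pi.mul_apply, hg, hh, hq, Real.sq_sqrt ht.le]
      rw [mul_div_cancel_left₀ _ ht.ne']
    rw [lintegral_congr h1, ← lintegral_map hhm (measurable_const_smul _),
      Measure.map_addHaar_smul μ hs.ne', lintegral_smul_measure, smul_eq_mul, hd,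
      ← lintegral_const_mul _ hhm, ← lintegral_const_mul _ (hhm.const_mul _)]
    refine lintegral_congr fun v => ?_
    rw [hh, ← mul_assoc, ← mul_assoc, ← ENNReal.ofReal_mul (invGammaPDFReal_nonneg hα hβ t),
      ← ENNReal.ofReal_mul (mul_nonneg (invGammaPDFReal_nonneg hα hβ t) (abs_nonneg _))]
    congr 2
    have : |(√t ^ d)⁻¹| = t ^ (-(d : ℝ) / 2) := by
      rw [abs_of_pos (by positivity), Real.sqrt_eq_rpow, ← Real.rpow_natCast,
        ← Real.rpow_mul ht.le, ← Real.rpow_neg ht.le]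
      congr 1
      ring
    rw [this]
    ring
  simp_rw [hleft]
  rw [lintegral_lintegral_swap hG.aemeasurable]
  refine lintegral_congr fun v => ?_
  rw [Pi.mul_apply, ← lintegral_const_mul (f := fun t => ENNReal.ofReal
    (invGammaPDFReal (α + d / 2) (β + q v / 2) t) * F t v) _
    (((measurable_invGammaPDFReal _ _).ennreal_ofReal).mul (hFv v))]
  refine lintegral_congr fun t => ?_
  rw [← mul_assoc (ENNReal.ofReal (mixtureDensity d α β (q v))),
    ← ENNReal.ofReal_mul (mixtureDensity_nonneg d hα hβ (hq0 v))]
  by_cases ht : 0 < t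
  · rw [invGammaPDFReal_mul_gaussian d hα hβ (hq0 v) ht]
  · simp [invGammaPDFReal, ht]

/-! ### Conditional distributions given by a randomization -/

/-- If `(X, Y)` has the law of `(X, H X τ)` with `τ` independent of `X`, the law of `H a τ` is a
conditional law at `a`. Its weak continuity is dominated convergence, as `f (H a τ)` is bounded and
continuous in `a`. -/
theorem isContCondDistrib_of_randomization {Ω 𝓧 𝓨 T : Type*} [MeasurableSpace Ω]
    [TopologicalSpace 𝓧] [FirstCountableTopology 𝓧] [MeasurableSpace 𝓧]
    [TopologicalSpace 𝓨] [MeasurableSpace 𝓨] [BorelSpace 𝓨] [StandardBorelSpace 𝓨] [Nonempty 𝓨]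
    [MeasurableSpace T] {Y : Ω → 𝓨} {X : Ω → 𝓧} {P : Measure Ω} [IsFiniteMeasure P]
    (hY : AEMeasurable Y P) (hX : AEMeasurable X P) {κ : 𝓧 → Measure 𝓨}
    (ρ : Measure T) [IsProbabilityMeasure ρ] (H : 𝓧 → T → 𝓨)
    (hH : Measurable (Function.uncurry H)) (hHc : ∀ t, Continuous fun a => H a t)
    (hκ : ∀ a, κ a = ρ.map (H a))
    (hjoint : ∀ F : 𝓧 → 𝓨 → ENNReal, Measurable (Function.uncurry F) →
      ∫⁻ ω, F (X ω) (Y ω) ∂P = ∫⁻ ω, ∫⁻ t, F (X ω) (H (X ω) t) ∂ρ ∂P) :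
    IsContCondDistrib Y X P κ := by
  have hHa : ∀ a, Measurable (H a) := fun a => hH.comp measurable_prodMk_left
  refine ⟨fun a => ?_, fun f => ?_, ?_⟩
  · rw [hκ]
    exact Measure.isProbabilityMeasure_map (hHa a).aemeasurable
  · have : ∀ a, ∫ y, f y ∂(κ a) = ∫ t, f (H a t) ∂ρ := fun a => by
      rw [hκ, integral_map (hHa a).aemeasurable
        f.continuous.measurable.aestronglyMeasurable]
    simp_rw [this]
    refine continuous_of_dominated (bound := fun _ => ‖f‖)
      (fun a => (f.continuous.measurable.comp (hHa a)).aestronglyMeasurable)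
      (fun a => Filter.Eventually.of_forall fun t => f.norm_coe_le_norm _)
      (integrable_const _) (Filter.Eventually.of_forall fun t => f.continuous.comp (hHc t))
  -- `κ` is only a family of measures; `K` bundles it as a kernel, so that a.e. uniqueness of
  -- disintegrations applies.
  · set K : Kernel 𝓧 𝓨 := (Kernel.id ×ₖ Kernel.const 𝓧 ρ).map (Function.uncurry H) with hK
    have hKa : ∀ a, K a = κ a := fun a => by
      rw [hK, Kernel.map_apply _ hH, Kernel.prod_apply, Kernel.id_apply, Kernel.const_apply,
        Measure.dirac_prod, Measure.map_map hH measurable_prodMk_left, hκ]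
      rfl
    have : IsFiniteKernel K := by
      rw [hK]
      infer_instance
    have key : P.map (fun ω => (X ω, Y ω)) = P.map X ⊗ₘ K := by
      refine Measure.ext_of_lintegral _ fun F hF => ?_
      have hm : Measurable fun a => ∫⁻ t, F (a, H a t) ∂ρ :=
        Measurable.lintegral_prod_right' (f := fun p : 𝓧 × T => F (p.1, H p.1 p.2))
          (hF.comp (measurable_fst.prodMk hH))
      rw [lintegral_map' hF.aemeasurable (hX.prodMk hY), Measure.lintegral_compProd hF,
        hjoint (fun a y => F (a, y)) hF]
      have : ∀ a, ∫⁻ y, F (a, y) ∂(K a) = ∫⁻ t, F (a, H a t) ∂ρ := fun a => by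
        rw [hKa, hκ, lintegral_map (f := fun y => F (a, y)) (hF.comp measurable_prodMk_left) (hHa a)]
      simp_rw [this]
      rw [lintegral_map' hm.aemeasurable hX]
    filter_upwards [condDistrib_ae_eq_of_measure_eq_compProd X hY key] with a ha
    rw [ha, hKa]

/-! ### Densities of standard normal vectors -/

theorem stdGaussian_eq_withDensity (p : ℕ) :
    stdGaussian (EuclideanSpace ℝ (Fin p)) = volume.withDensity fun w =>
      ENNReal.ofReal ((2 * Real.pi) ^ (-(p : ℝ) / 2) * Real.exp (-‖w‖ ^ 2 / 2)) := by
  have h1 : Measure.pi (fun _ : Fin p => gaussianReal 0 1) = volume.withDensity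
      fun x : Fin p → ℝ => ENNReal.ofReal (∏ i, gaussianPDFReal 0 1 (x i)) := by
    rw [gaussianReal_of_var_ne_zero 0 one_ne_zero]
    exact pi_withDensity_ofReal (fun _ : Fin p => (volume : Measure ℝ))
      (fun _ => gaussianPDFReal 0 1) (fun _ => gaussianPDFReal_nonneg 0 1)
      (fun _ => integrable_gaussianPDFReal 0 1)
  have h2 : ∀ x : Fin p → ℝ, ∏ i, gaussianPDFReal 0 1 (x i) =
      (2 * Real.pi) ^ (-(p : ℝ) / 2) * Real.exp (-‖WithLp.toLp 2 x‖ ^ 2 / 2) := by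
    intro x
    simp only [gaussianPDFReal, Finset.prod_mul_distrib, NNReal.coe_one, mul_one, sub_zero,
      ← Real.exp_sum, EuclideanSpace.real_norm_sq_eq, Finset.prod_const, Finset.card_univ,
      Fintype.card_fin]
    rw [← Finset.sum_div, Finset.sum_neg_distrib, Real.sqrt_eq_rpow,
      ← Real.rpow_neg (by positivity), ← Real.rpow_mul_natCast (by positivity)]
    congr 2
    ring
  rw [← map_pi_eq_stdGaussian, h1]
  have hm : Measurable fun w : EuclideanSpace ℝ (Fin p) =>
      ENNReal.ofReal ((2 * Real.pi) ^ (-(p : ℝ) / 2) * Real.exp (-‖w‖ ^ 2 / 2)) := by fun_prop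
  have hm2 : Measurable fun x : Fin p → ℝ =>
      ENNReal.ofReal (∏ i, gaussianPDFReal 0 1 (x i)) := by fun_prop
  refine Measure.ext_of_lintegral _ fun f hf => ?_
  rw [lintegral_map hf (by fun_prop), lintegral_withDensity_eq_lintegral_mul _ hm2
    (g := fun x => f (WithLp.toLp 2 x)) (hf.comp (WithLp.measurable_toLp 2 _)),
    lintegral_withDensity_eq_lintegral_mul _ hm hf,
    ← (EuclideanSpace.volume_preserving_symm_measurableEquiv_toLp (Fin p)).symm.map_eq,
    lintegral_map (hm.mul hf) (by fun_prop)]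
  refine lintegral_congr fun x => ?_
  simp only [Pi.mul_apply, h2]
  rfl

/-- The exponent is a sum of squares, not the squared norm of `w`, since the product carries the sup
norm. This is why the conjugacy lemma takes a general quadratically homogeneous `q`. -/
theorem pi_stdGaussian_eq_withDensity (k p : ℕ) :
    Measure.pi (fun _ : Fin k => stdGaussian (EuclideanSpace ℝ (Fin p))) =
      volume.withDensity fun w => ENNReal.ofReal
        ((2 * Real.pi) ^ (-((k * p : ℕ) : ℝ) / 2) * Real.exp (-(∑ i, ‖w i‖ ^ 2) / 2)) := by
  have hint : Integrable fun w : EuclideanSpace ℝ (Fin p) =>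
      (2 * Real.pi) ^ (-(p : ℝ) / 2) * Real.exp (-‖w‖ ^ 2 / 2) := by
    refine ⟨by fun_prop, ?_⟩
    rw [hasFiniteIntegral_iff_ofReal (Filter.Eventually.of_forall fun w => by positivity),
      ← setLIntegral_univ, ← withDensity_apply _ MeasurableSet.univ,
      ← stdGaussian_eq_withDensity]
    exact measure_lt_top _ _
  rw [stdGaussian_eq_withDensity, pi_withDensity_ofReal (fun _ : Fin k =>
    (volume : Measure (EuclideanSpace ℝ (Fin p)))) _ (fun _ _ => by positivity) fun _ => hint]
  congr 1
  ext w
  congr 1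
  rw [Finset.prod_mul_distrib, ← Real.exp_sum, ← Finset.sum_div, Finset.sum_neg_distrib,
    Finset.prod_const, Finset.card_univ, Fintype.card_fin, ← Real.rpow_mul_natCast (by positivity)]
  congr 2
  push_cast
  ring

/-! ### Matrices acting on Euclidean spaces -/

theorem continuous_toEuclideanLin {m n : ℕ} (M : Matrix (Fin n) (Fin m) ℝ) :
    Continuous (toEuclideanLin M) :=
  LinearMap.continuous_of_finiteDimensional _

@[fun_prop]
theorem Continuous.toEuclideanLin {X : Type*} [TopologicalSpace X] {m n : ℕ}
    (M : Matrix (Fin n) (Fin m) ℝ) {f : X → EuclideanSpace ℝ (Fin m)} (hf : Continuous f) :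
    Continuous fun a => Matrix.toEuclideanLin M (f a) :=
  (continuous_toEuclideanLin M).comp hf

@[fun_prop]
theorem Measurable.toEuclideanLin {X : Type*} [MeasurableSpace X] {m n : ℕ}
    (M : Matrix (Fin n) (Fin m) ℝ) {f : X → EuclideanSpace ℝ (Fin m)} (hf : Measurable f) :
    Measurable fun a => Matrix.toEuclideanLin M (f a) :=
  (continuous_toEuclideanLin M).measurable.comp hf

theorem inner_toEuclideanLin_left {m n : ℕ} (M : Matrix (Fin n) (Fin m) ℝ)
    (u : EuclideanSpace ℝ (Fin m)) (ξ : EuclideanSpace ℝ (Fin n)) :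
    inner ℝ (toEuclideanLin M u) ξ = inner ℝ u (toEuclideanLin Mᵀ ξ) := by
  rw [← conjTranspose_eq_transpose_of_trivial, toEuclideanLin_conjTranspose_eq_adjoint,
    LinearMap.adjoint_inner_right]

theorem norm_sq_toEuclideanLin {m n : ℕ} (M : Matrix (Fin n) (Fin m) ℝ)
    (u : EuclideanSpace ℝ (Fin m)) :
    ‖toEuclideanLin M u‖ ^ 2 = u.ofLp ⬝ᵥ (Mᵀ * M) *ᵥ u.ofLp := by
  rw [← real_inner_self_eq_norm_sq, inner_toEuclideanLin_left]
  simp [toLpLin_apply, PiLp.inner_apply, dotProduct, mul_comm]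

/-- The characteristic functions agree because `ξᵀ (V Vᵀ + Y Yᵀ) ξ = ‖Vᵀ ξ‖² + ‖Yᵀ ξ‖²`. -/
theorem multivariateGaussian_eq_map_prod {n m p : ℕ} (x₀ : EuclideanSpace ℝ (Fin n))
    (V : Matrix (Fin n) (Fin m) ℝ) (Y : Matrix (Fin n) (Fin p) ℝ) :
    multivariateGaussian x₀ (V * Vᵀ + Y * Yᵀ) =
      ((stdGaussian (EuclideanSpace ℝ (Fin m))).prod
        (stdGaussian (EuclideanSpace ℝ (Fin p)))).map
        fun q => x₀ + toEuclideanLin V q.1 + toEuclideanLin Y q.2 := by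
  have hS : (V * Vᵀ + Y * Yᵀ).PosSemidef := by
    simpa using (posSemidef_self_mul_conjTranspose V).add (posSemidef_self_mul_conjTranspose Y)
  have hm : Measurable fun q : EuclideanSpace ℝ (Fin m) × EuclideanSpace ℝ (Fin p) =>
    x₀ + toEuclideanLin V q.1 + toEuclideanLin Y q.2 := by fun_prop
  have : IsProbabilityMeasure (((stdGaussian (EuclideanSpace ℝ (Fin m))).prod
        (stdGaussian (EuclideanSpace ℝ (Fin p)))).map
        fun q => x₀ + toEuclideanLin V q.1 + toEuclideanLin Y q.2) :=
    Measure.isProbabilityMeasure_map hm.aemeasurable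
  refine Measure.ext_of_charFun ?_
  ext ξ
  rw [charFun_multivariateGaussian hS, charFun_apply, integral_map hm.aemeasurable
    (by fun_prop)]
  have h1 : ∀ q : EuclideanSpace ℝ (Fin m) × EuclideanSpace ℝ (Fin p),
      Complex.exp ((inner ℝ (x₀ + toEuclideanLin V q.1 + toEuclideanLin Y q.2) ξ : ℝ) *
        Complex.I) =
      Complex.exp ((inner ℝ ξ x₀ : ℝ) * Complex.I) *
      (Complex.exp ((inner ℝ q.1 (toEuclideanLin Vᵀ ξ) : ℝ) * Complex.I) *
        Complex.exp ((inner ℝ q.2 (toEuclideanLin Yᵀ ξ) : ℝ) * Complex.I)) := by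
    intro q
    rw [inner_add_left, inner_add_left, inner_toEuclideanLin_left, inner_toEuclideanLin_left,
      real_inner_comm, ← Complex.exp_add, ← Complex.exp_add]
    push_cast
    ring_nf
  simp_rw [h1]
  rw [integral_const_mul, integral_prod_mul
    (fun u : EuclideanSpace ℝ (Fin m) =>
      Complex.exp ((inner ℝ u (toEuclideanLin Vᵀ ξ) : ℝ) * Complex.I))
    (fun w : EuclideanSpace ℝ (Fin p) =>
      Complex.exp ((inner ℝ w (toEuclideanLin Yᵀ ξ) : ℝ) * Complex.I)),
    ← charFun_apply, ← charFun_apply, charFun_stdGaussian, charFun_stdGaussian,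
    ← Complex.exp_add, ← Complex.exp_add]
  congr 1
  have h2 : (ξ.ofLp ⬝ᵥ (V * Vᵀ + Y * Yᵀ) *ᵥ ξ.ofLp : ℝ) =
      ‖toEuclideanLin Vᵀ ξ‖ ^ 2 + ‖toEuclideanLin Yᵀ ξ‖ ^ 2 := by
    rw [norm_sq_toEuclideanLin, norm_sq_toEuclideanLin, transpose_transpose, transpose_transpose,
      add_mulVec, dotProduct_add]
  rw [h2]
  push_cast
  ring

theorem projPrior_smul_one {n m p : ℕ} (x₀ : EuclideanSpace ℝ (Fin n))
    (V : Matrix (Fin n) (Fin m) ℝ) (Y : Matrix (Fin n) (Fin p) ℝ) {t : ℝ} (ht : 0 < t) :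
    projPrior x₀ V Y (t • 1) =
      ((stdGaussian (EuclideanSpace ℝ (Fin m))).prod
        (stdGaussian (EuclideanSpace ℝ (Fin p)))).map
        fun q => x₀ + toEuclideanLin V q.1 + toEuclideanLin Y (√t • q.2) := by
  have h : Y * (t • (1 : Matrix (Fin p) (Fin p) ℝ)) * Yᵀ = (√t • Y) * (√t • Y)ᵀ := by
    simp [smul_smul, Real.mul_self_sqrt ht.le]
  rw [projPrior, h, multivariateGaussian_eq_map_prod]
  simp

/-! ### Pseudo-inverse, pseudo-determinant and range of `c • Y Yᵀ` -/

/-- On eigenvalues this is `t * t⁻¹ * t = t`, true also at `t = 0`. The finite spectrum makes `t⁻¹`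
continuous on it. -/
theorem mul_symmPinv_mul_self {n : ℕ} {S : Matrix (Fin n) (Fin n) ℝ} (hS : S.IsHermitian) :
    S * symmPinv S * S = S := by
  have hs : IsSelfAdjoint S := hS
  have hc : ContinuousOn (fun t : ℝ => t⁻¹) (spectrum ℝ S) :=
    (Matrix.finite_real_spectrum (A := S)).continuousOn _
  unfold symmPinv
  nth_rw 1 3 4 [← cfc_id ℝ S hs]
  rw [← cfc_mul _ _ S continuousOn_id hc,
    ← cfc_mul (fun t : ℝ => id t * t⁻¹) _ S (continuousOn_id.mul hc) continuousOn_id]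
  refine cfc_congr fun t _ => ?_
  simp

theorem isHermitian_smul_mul_transpose {n p : ℕ} (Y : Matrix (Fin n) (Fin p) ℝ) (c : ℝ) :
    (c • (Y * Yᵀ)).IsHermitian := by
  rw [IsHermitian, conjTranspose_eq_transpose_of_trivial]
  simp

/-- In `S S† S = S` with `S = c Y Yᵀ`, the outer factors `Y` and `Yᵀ` cancel through the left
inverse `(Yᵀ Y)⁻¹ Yᵀ` and its transpose. -/
theorem transpose_mul_symmPinv_mul {n p : ℕ} {Y : Matrix (Fin n) (Fin p) ℝ}
    (hY : (Yᵀ * Y).det ≠ 0) {c : ℝ} (hc : c ≠ 0) :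
    Yᵀ * symmPinv (c • (Y * Yᵀ)) * Y = c⁻¹ • 1 := by
  have hu : IsUnit (Yᵀ * Y).det := isUnit_iff_ne_zero.2 hY
  set X := Yᵀ * symmPinv (c • (Y * Yᵀ)) * Y with hX
  have h := mul_symmPinv_mul_self (isHermitian_smul_mul_transpose Y c)
  have h1 : (c * c) • (Y * X * Yᵀ) = c • (Y * Yᵀ) := by
    rw [← h, hX]
    simp only [Matrix.smul_mul, Matrix.mul_smul, smul_smul, Matrix.mul_assoc]
  have h2 : (Yᵀ * Y)⁻¹ * Yᵀ * ((c * c) • (Y * X * Yᵀ)) * (Y * (Yᵀ * Y)⁻¹) = (c * c) • X := by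
    calc _ = (c * c) • (((Yᵀ * Y)⁻¹ * (Yᵀ * Y)) * X * ((Yᵀ * Y) * (Yᵀ * Y)⁻¹)) := by
          simp only [Matrix.smul_mul, Matrix.mul_smul, Matrix.mul_assoc]
      _ = _ := by rw [nonsing_inv_mul _ hu, mul_nonsing_inv _ hu, Matrix.one_mul, Matrix.mul_one]
  have h3 : (Yᵀ * Y)⁻¹ * Yᵀ * (c • (Y * Yᵀ)) * (Y * (Yᵀ * Y)⁻¹) = c • 1 := by
    calc _ = c • (((Yᵀ * Y)⁻¹ * (Yᵀ * Y)) * ((Yᵀ * Y) * (Yᵀ * Y)⁻¹)) := by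
          simp only [Matrix.smul_mul, Matrix.mul_smul, Matrix.mul_assoc]
      _ = _ := by rw [nonsing_inv_mul _ hu, mul_nonsing_inv _ hu, Matrix.one_mul]
  rw [h1, h3] at h2
  have h4 : c⁻¹ • (c⁻¹ • ((c * c) • X)) = X := by
    rw [smul_smul, smul_smul]
    field_simp
    simp
  rw [← h4, ← h2, smul_smul c⁻¹ c, inv_mul_cancel₀ hc, one_smul]

/-- `(c Y) Yᵀ` and `Yᵀ (c Y)` have the same characteristic polynomial up to powers of `X`, hence the
same nonzero eigenvalues, and the second matrix is invertible. -/
theorem pseudoDet_smul_mul_transpose {n p : ℕ} {Y : Matrix (Fin n) (Fin p) ℝ}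
    (hY : (Yᵀ * Y).det ≠ 0) {c : ℝ} (hc : c ≠ 0) :
    pseudoDet (c • (Y * Yᵀ)) = c ^ p * (Yᵀ * Y).det := by
  have h := congrArg Polynomial.roots (charpoly_mul_comm' (c • Y) Yᵀ)
  rw [Polynomial.roots_mul, Polynomial.roots_mul, Polynomial.roots_pow, Polynomial.roots_pow,
    Polynomial.roots_X] at h
  rotate_left
  · exact mul_ne_zero (pow_ne_zero _ Polynomial.X_ne_zero) (charpoly_monic _).ne_zero
  · exact mul_ne_zero (pow_ne_zero _ Polynomial.X_ne_zero) (charpoly_monic _).ne_zero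
  have h2 := congrArg (Multiset.filter fun t => t ≠ 0) h
  rw [Multiset.filter_add, Multiset.filter_add, Multiset.nsmul_singleton,
    Multiset.nsmul_singleton] at h2
  have h0 : ∀ l : ℕ, Multiset.filter (fun t : ℝ => t ≠ 0) (Multiset.replicate l 0) = 0 := by
    intro l
    rw [Multiset.filter_eq_nil]
    intro a ha
    simp [Multiset.eq_of_mem_replicate ha]
  rw [h0, h0, zero_add, zero_add] at h2
  have hD : (Yᵀ * (c • Y)).det = c ^ p * (Yᵀ * Y).det := by
    rw [Matrix.mul_smul, det_smul, Fintype.card_fin]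
  have hH : (Yᵀ * (c • Y)).IsHermitian := by
    rw [IsHermitian, conjTranspose_eq_transpose_of_trivial]
    simp
  have hprod := det_eq_prod_roots_charpoly_of_splits hH.splits_charpoly
  have hne : ∀ t ∈ (Yᵀ * (c • Y)).charpoly.roots, t ≠ 0 := by
    rintro t ht rfl
    rw [Multiset.prod_eq_zero ht, hD] at hprod
    exact mul_ne_zero (pow_ne_zero _ hc) hY hprod
  rw [pseudoDet, ← Matrix.smul_mul, h2, Multiset.filter_eq_self.2 hne, ← hprod, hD]

theorem range_toEuclideanLin_smul_mul_transpose {n p : ℕ} {Y : Matrix (Fin n) (Fin p) ℝ}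
    (hY : (Yᵀ * Y).det ≠ 0) {c : ℝ} (hc : c ≠ 0) :
    LinearMap.range (toEuclideanLin (c • (Y * Yᵀ))) = LinearMap.range (toEuclideanLin Y) := by
  have hu : IsUnit (Yᵀ * Y).det := isUnit_iff_ne_zero.2 hY
  apply le_antisymm
  · have h : c • (Y * Yᵀ) = Y * (c • Yᵀ) := by simp
    rw [h]
    erw [toLpLin_mul_same]
    exact LinearMap.range_comp_le_range _ _
  · have h : Y = (c • (Y * Yᵀ)) * (c⁻¹ • (Y * (Yᵀ * Y)⁻¹)) := by
      rw [Matrix.smul_mul, Matrix.mul_smul, smul_smul, mul_inv_cancel₀ hc, one_smul,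
        Matrix.mul_assoc, ← Matrix.mul_assoc Yᵀ, mul_nonsing_inv _ hu, Matrix.mul_one]
    conv_lhs => rw [h]
    erw [toLpLin_mul_same]
    exact LinearMap.range_comp_le_range _ _

theorem injective_toEuclideanLin {n p : ℕ} {Y : Matrix (Fin n) (Fin p) ℝ}
    (hY : (Yᵀ * Y).det ≠ 0) : Function.Injective (toEuclideanLin Y) := by
  have hu : IsUnit (Yᵀ * Y).det := isUnit_iff_ne_zero.2 hY
  refine Function.LeftInverse.injective (g := toEuclideanLin ((Yᵀ * Y)⁻¹ * Yᵀ)) fun w => ?_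
  simp only [toLpLin_apply, mulVec_mulVec, Matrix.mul_assoc, nonsing_inv_mul _ hu, one_mulVec]

theorem finrank_range_toEuclideanLin {n p : ℕ} {Y : Matrix (Fin n) (Fin p) ℝ}
    (hY : (Yᵀ * Y).det ≠ 0) :
    Module.finrank ℝ (LinearMap.range (toEuclideanLin Y)) = p := by
  rw [LinearMap.finrank_range_of_inj (injective_toEuclideanLin hY), finrank_euclideanSpace_fin]

theorem rank_smul_mul_transpose {n p : ℕ} {Y : Matrix (Fin n) (Fin p) ℝ}
    (hY : (Yᵀ * Y).det ≠ 0) {c : ℝ} (hc : c ≠ 0) : (c • (Y * Yᵀ)).rank = p := by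
  rw [rank_eq_finrank_range_toLin _ (PiLp.basisFun 2 ℝ (Fin n)) (PiLp.basisFun 2 ℝ (Fin n)),
    ← toLpLin_eq_toLin]
  exact (congrArg (fun R : Submodule ℝ (EuclideanSpace ℝ (Fin n)) => Module.finrank ℝ R)
    (range_toEuclideanLin_smul_mul_transpose hY hc)).trans (finrank_range_toEuclideanLin hY)

/-! ### Lebesgue measure on affine subspaces -/

theorem abs_det_eq_sqrt_det_transpose_mul {n p : ℕ} (Y : Matrix (Fin n) (Fin p) ℝ)
    (f : EuclideanSpace ℝ (Fin p) →ₗ[ℝ] EuclideanSpace ℝ (Fin p))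
    (hf : ∀ w, ‖f w‖ = ‖toEuclideanLin Y w‖) : |LinearMap.det f| = √(Yᵀ * Y).det := by
  obtain ⟨M, rfl⟩ := (toEuclideanLin (𝕜 := ℝ) (m := Fin p) (n := Fin p)).surjective f
  have hdet : LinearMap.det (toEuclideanLin M) = M.det := by
    rw [show toEuclideanLin M = toLin (PiLp.basisFun 2 ℝ (Fin p)) (PiLp.basisFun 2 ℝ (Fin p)) M
      from congrFun (congrArg _ (toLpLin_eq_toLin 2 2)) M, LinearMap.det_toLin]
  -- Equal norms give equal inner products by polarization, hence equal Gram matrices.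
  have hM : Mᵀ * M = Yᵀ * Y := by
    have hin : ∀ u v, inner ℝ (toEuclideanLin M u) (toEuclideanLin M v) =
        inner ℝ (toEuclideanLin Y u) (toEuclideanLin Y v) := by
      intro u v
      rw [real_inner_eq_norm_add_mul_self_sub_norm_mul_self_sub_norm_mul_self_div_two,
        real_inner_eq_norm_add_mul_self_sub_norm_mul_self_sub_norm_mul_self_div_two,
        ← map_add, ← map_add, hf, hf, hf]
    apply (toEuclideanLin (𝕜 := ℝ) (m := Fin p) (n := Fin p)).injective
    refine LinearMap.ext fun v => ext_inner_left ℝ fun u => ?_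
    have h := hin u v
    rw [inner_toEuclideanLin_left, inner_toEuclideanLin_left] at h
    simpa only [toLpLin_apply, mulVec_mulVec] using h
  rw [hdet, ← hM, det_mul, det_transpose, Real.sqrt_mul_self_eq_abs]

/-- In orthonormal coordinates on its range, `Y` becomes an endomorphism with Jacobian `√(det (Yᵀ
Y))`. -/
theorem map_volume_toEuclideanLin {n p : ℕ} (μ : EuclideanSpace ℝ (Fin n))
    {Y : Matrix (Fin n) (Fin p) ℝ} (hY : 0 < (Yᵀ * Y).det) :
    (volume : Measure (EuclideanSpace ℝ (Fin p))).map (fun w => μ + toEuclideanLin Y w) =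
      ENNReal.ofReal (√(Yᵀ * Y).det)⁻¹ •
        affineVolume μ (LinearMap.range (toEuclideanLin Y)) := by
  set R := LinearMap.range (toEuclideanLin Y) with hR
  set b : OrthonormalBasis (Fin p) ℝ R :=
    (stdOrthonormalBasis ℝ R).reindex (finCongr (finrank_range_toEuclideanLin hY.ne'))
  set f : EuclideanSpace ℝ (Fin p) →ₗ[ℝ] EuclideanSpace ℝ (Fin p) :=
    b.repr.toLinearEquiv.toLinearMap ∘ₗ (toEuclideanLin Y).rangeRestrict with hf
  have hfa : ∀ w, f w = b.repr ((toEuclideanLin Y).rangeRestrict w) := fun w => rfl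
  have hdet : |LinearMap.det f| = √(Yᵀ * Y).det :=
    abs_det_eq_sqrt_det_transpose_mul Y f fun w => by
      rw [hfa, LinearIsometryEquiv.norm_map]
      rfl
  have hdet0 : LinearMap.det f ≠ 0 := by
    rw [← abs_pos, hdet]
    exact Real.sqrt_pos.2 hY
  have hcomp : (fun w => μ + toEuclideanLin Y w) =
      (fun r : R => μ + (r : EuclideanSpace ℝ (Fin n))) ∘ b.repr.symm ∘ f := by
    ext1 w
    simp [hfa]
  have hm : Measurable fun r : R => μ + (r : EuclideanSpace ℝ (Fin n)) := by fun_prop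
  have hfm : Measurable f := f.continuous_of_finiteDimensional.measurable
  rw [hcomp, ← Measure.map_map hm (by fun_prop), ← Measure.map_map (by fun_prop) hfm,
    Measure.map_linearMap_addHaar_eq_smul_addHaar _ hdet0, Measure.map_smul, Measure.map_smul,
    b.measurePreserving_repr_symm.map_eq, abs_inv, hdet, affineVolume,
    OrthonormalBasis.addHaar_eq_volume]

/-! ### The multivariate Student distribution as a variance mixture -/

theorem measurable_studentPDFReal {n : ℕ} (ν : ℝ) (μ : EuclideanSpace ℝ (Fin n))
    (S : Matrix (Fin n) (Fin n) ℝ) : Measurable (studentPDFReal ν μ S) := by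
  unfold studentPDFReal
  have : Continuous fun x : EuclideanSpace ℝ (Fin n) =>
      (x - μ).ofLp ⬝ᵥ symmPinv S *ᵥ (x - μ).ofLp := by fun_prop
  have := this.measurable
  fun_prop

/-- The Jacobian cancels the factor `det (Yᵀ Y)` of the pseudo-determinant, leaving a density that
depends on `Y` only through the coordinate `v`. -/
theorem studentPDFReal_add_toEuclideanLin {n p : ℕ} (μ : EuclideanSpace ℝ (Fin n))
    {Y : Matrix (Fin n) (Fin p) ℝ} (hY : 0 < (Yᵀ * Y).det) {α β : ℝ} (hα : 0 < α) (hβ : 0 < β)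
    (v : EuclideanSpace ℝ (Fin p)) :
    √(Yᵀ * Y).det * studentPDFReal (2 * α) μ ((β / α) • (Y * Yᵀ)) (μ + toEuclideanLin Y v) =
      mixtureDensity p α β (‖v‖ ^ 2) := by
  have hc : 0 < β / α := by positivity
  have hq : (μ + toEuclideanLin Y v - μ).ofLp ⬝ᵥ
      symmPinv ((β / α) • (Y * Yᵀ)) *ᵥ (μ + toEuclideanLin Y v - μ).ofLp = α / β * ‖v‖ ^ 2 := by
    rw [add_sub_cancel_left, toLpLin_apply, mulVec_mulVec, dotProduct_comm, dotProduct_mulVec,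
      ← mulVec_transpose, mulVec_mulVec, dotProduct_comm, ← Matrix.mul_assoc,
      transpose_mul_symmPinv_mul hY.ne' hc.ne', smul_mulVec, one_mulVec, dotProduct_smul,
      inv_div, EuclideanSpace.real_norm_sq_eq, smul_eq_mul]
    simp only [dotProduct, sq]
  have hb : 0 < β + ‖v‖ ^ 2 / 2 := by positivity
  have hD := (Real.sqrt_pos.2 hY).ne'
  have h1 : 1 + 1 / (2 * α) * (α / β * ‖v‖ ^ 2) = (β + ‖v‖ ^ 2 / 2) / β := by
    field_simp
  have h2 : (2 * α + p) / 2 = α + p / 2 := by ring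
  have h3 : √((Real.pi * (2 * α)) ^ p * ((β / α) ^ p * (Yᵀ * Y).det)) =
      (2 * Real.pi) ^ ((p : ℝ) / 2) * β ^ ((p : ℝ) / 2) * √(Yᵀ * Y).det := by
    rw [← mul_assoc, ← mul_pow, Real.sqrt_mul (by positivity),
      ← Real.mul_rpow (by positivity) hβ.le, Real.sqrt_eq_rpow, ← Real.rpow_natCast,
      ← Real.rpow_mul (by positivity)]
    congr 2
    · field_simp
    · ring
  have hG := (Real.Gamma_pos_of_pos hα).ne'
  rw [studentPDFReal, hq, rank_smul_mul_transpose hY.ne' hc.ne',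
    pseudoDet_smul_mul_transpose hY.ne' hc.ne', h1, h2, h3, mixtureDensity,
    Real.div_rpow hb.le hβ.le, Real.rpow_neg hb.le, mul_div_cancel_left₀ _ two_ne_zero,
    neg_div, Real.rpow_neg (by positivity), Real.rpow_add hβ]
  have := (Real.rpow_pos_of_pos hb (α + p / 2)).ne'
  have := (Real.rpow_pos_of_pos hβ ((p : ℝ) / 2)).ne'
  field_simp

/-- Conjugacy applied to an integrand independent of the scale: the inner posterior integrates to
one and only the marginal density remains. -/
theorem studentMeasure_eq_map {n p : ℕ} (μ : EuclideanSpace ℝ (Fin n))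
    {Y : Matrix (Fin n) (Fin p) ℝ} (hY : 0 < (Yᵀ * Y).det) {α β : ℝ} (hα : 0 < α) (hβ : 0 < β) :
    studentMeasure (2 * α) μ ((β / α) • (Y * Yᵀ)) =
      ((invGammaMeasure α β).prod (stdGaussian (EuclideanSpace ℝ (Fin p)))).map
        fun q => μ + toEuclideanLin Y (√q.1 • q.2) := by
  have hc : 0 < β / α := by positivity
  have := isProbabilityMeasure_invGammaMeasure hα hβ
  refine Measure.ext_of_lintegral _ fun f hf => ?_
  have hT : Measurable fun v => μ + toEuclideanLin Y v := by fun_prop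
  have hpdf := (measurable_studentPDFReal (2 * α) μ ((β / α) • (Y * Yᵀ))).ennreal_ofReal
  rw [lintegral_map hf (by fun_prop), lintegral_prod _ (by fun_prop),
    lintegral_invGammaMeasure_gaussian volume finrank_euclideanSpace_fin
      (q := fun v : EuclideanSpace ℝ (Fin p) => ‖v‖ ^ 2) (by fun_prop) (fun v => by positivity)
      (fun c v => by rw [norm_smul, mul_pow, Real.norm_eq_abs, sq_abs])
      (stdGaussian_eq_withDensity p) hα hβ (F := fun _ v => f (μ + toEuclideanLin Y v))
      (by fun_prop)]
  have hmix : Measurable fun v : EuclideanSpace ℝ (Fin p) =>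
      ENNReal.ofReal (mixtureDensity p α β (‖v‖ ^ 2)) :=
    ((measurable_mixtureDensity p α β).comp (by fun_prop)).ennreal_ofReal
  have hprob : ∀ v : EuclideanSpace ℝ (Fin p),
      IsProbabilityMeasure (invGammaMeasure (α + p / 2) (β + ‖v‖ ^ 2 / 2)) := fun v =>
    isProbabilityMeasure_invGammaMeasure (by positivity) (by positivity)
  simp_rw [lintegral_const, measure_univ, mul_one]
  have hvol : affineVolume μ (LinearMap.range (toEuclideanLin Y)) =
      ENNReal.ofReal (√(Yᵀ * Y).det) •
        (volume : Measure (EuclideanSpace ℝ (Fin p))).map (fun w => μ + toEuclideanLin Y w) := by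
    rw [map_volume_toEuclideanLin μ hY, smul_smul, ← ENNReal.ofReal_mul (Real.sqrt_nonneg _),
      mul_inv_cancel₀ (Real.sqrt_pos.2 hY).ne', ENNReal.ofReal_one, one_smul]
  rw [studentMeasure, range_toEuclideanLin_smul_mul_transpose hY.ne' hc.ne', hvol,
    lintegral_withDensity_eq_lintegral_mul _ hpdf hf, lintegral_smul_measure,
    lintegral_map (hpdf.mul hf) hT, smul_eq_mul,
    ← lintegral_const_mul (f := fun v => (_ * f) (μ + toEuclideanLin Y v)) _
      ((hpdf.mul hf).comp hT),
    lintegral_withDensity_eq_lintegral_mul _ hmix (g := fun v => f (μ + toEuclideanLin Y v))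
      (hf.comp hT)]
  refine lintegral_congr fun v => ?_
  rw [Pi.mul_apply, Pi.mul_apply, ← mul_assoc, ← ENNReal.ofReal_mul (Real.sqrt_nonneg _),
    studentPDFReal_add_toEuclideanLin μ hY hα hβ]

/-! ### Linear algebra of projection methods -/

theorem injective_mulVec_of_rank_eq {n m : ℕ} {V : Matrix (Fin n) (Fin m) ℝ}
    (hV : V.rank = m) : Function.Injective V.mulVec := by
  have h := V.mulVecLin.finrank_range_add_finrank_ker
  rw [show Module.finrank ℝ V.mulVecLin.range = V.rank from rfl, hV, Module.finrank_fin_fun] at h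
  have h0 : LinearMap.ker V.mulVecLin = ⊥ := Submodule.finrank_eq_zero.1 (by omega)
  exact LinearMap.ker_eq_bot.1 h0

theorem isUnit_det_transpose_mul_mul {n m : ℕ} {A : Matrix (Fin n) (Fin n) ℝ} (hA : A.PosDef)
    {V : Matrix (Fin n) (Fin m) ℝ} (hV : Function.Injective V.mulVec) :
    IsUnit (Vᵀ * A * V).det := by
  have h := hA.conjTranspose_mul_mul_same hV
  rw [conjTranspose_eq_transpose_of_trivial] at h
  exact isUnit_iff_ne_zero.2 h.det_pos.ne'

theorem det_transpose_mul_self_pos {n p : ℕ} {A : Matrix (Fin n) (Fin n) ℝ}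
    {Y : Matrix (Fin n) (Fin p) ℝ} (hYA : Yᵀ * A * Y = 1) : 0 < (Yᵀ * Y).det := by
  have hinj : Function.Injective Y.mulVec := by
    refine Function.LeftInverse.injective (g := (Yᵀ * A).mulVec) fun w => ?_
    rw [mulVec_mulVec, hYA, one_mulVec]
  have h := PosDef.conjTranspose_mul_self Y hinj
  rw [conjTranspose_eq_transpose_of_trivial] at h
  exact h.det_pos

theorem mul_eq_zero_of_range_eq_ker {n m p : ℕ} {B : Matrix (Fin m) (Fin n) ℝ}
    {Y : Matrix (Fin n) (Fin p) ℝ}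
    (hY : LinearMap.range Y.mulVecLin = LinearMap.ker B.mulVecLin) : B * Y = 0 := by
  refine ext_of_mulVec_single fun i => ?_
  rw [← mulVec_mulVec, zero_mulVec]
  have : Y.mulVecLin (Pi.single i 1) ∈ LinearMap.ker B.mulVecLin :=
    hY ▸ LinearMap.mem_range_self _ _
  simpa using this

theorem natCast_sub_eq_of_range_eq_ker {n m p : ℕ} {A : Matrix (Fin n) (Fin n) ℝ}
    {V : Matrix (Fin n) (Fin m) ℝ} {Y : Matrix (Fin n) (Fin p) ℝ}
    (hG : IsUnit (Vᵀ * A * V).det)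
    (hY : LinearMap.range Y.mulVecLin = LinearMap.ker (Vᵀ * A).mulVecLin)
    (hYA : Yᵀ * A * Y = 1) : (n : ℝ) - m = p := by
  have hinj : Function.Injective Y.mulVecLin := by
    refine Function.LeftInverse.injective (g := (Yᵀ * A).mulVec) fun w => ?_
    rw [mulVecLin_apply, mulVec_mulVec, hYA, one_mulVec]
  have hsurj : Function.Surjective (Vᵀ * A).mulVecLin := by
    refine Function.RightInverse.surjective (g := (V * (Vᵀ * A * V)⁻¹).mulVec) fun c => ?_
    rw [mulVecLin_apply, mulVec_mulVec, ← Matrix.mul_assoc, mul_nonsing_inv _ hG, one_mulVec]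
  have h := (Vᵀ * A).mulVecLin.finrank_range_add_finrank_ker
  rw [← hY, LinearMap.finrank_range_of_inj hinj, LinearMap.range_eq_top.2 hsurj, finrank_top,
    Module.finrank_fin_fun, Module.finrank_fin_fun, Module.finrank_fin_fun] at h
  rw [← h]
  push_cast
  ring

theorem scaledError_add {n m p : ℕ} {A : Matrix (Fin n) (Fin n) ℝ}
    {V : Matrix (Fin n) (Fin m) ℝ} {Y : Matrix (Fin n) (Fin p) ℝ}
    (hG : IsUnit (Vᵀ * A * V).det) (hVY : Vᵀ * A * Y = 0) (x₀ : EuclideanSpace ℝ (Fin n))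
    (u : EuclideanSpace ℝ (Fin m)) (w : EuclideanSpace ℝ (Fin p)) :
    scaledError A V V x₀ (x₀ + toEuclideanLin V u + toEuclideanLin Y w) =
      toEuclideanLin (CFC.sqrt A * Y) w := by
  have h1 : errorProj A V V * V = 0 := by
    rw [errorProj, Matrix.sub_mul, Matrix.one_mul, Matrix.mul_assoc, Matrix.mul_assoc,
      Matrix.mul_assoc, ← Matrix.mul_assoc Vᵀ, nonsing_inv_mul _ hG, Matrix.mul_one, sub_self]
  have h2 : errorProj A V V * Y = Y := by
    rw [errorProj, Matrix.sub_mul, Matrix.one_mul, Matrix.mul_assoc, Matrix.mul_assoc,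
      Matrix.mul_assoc, ← Matrix.mul_assoc Vᵀ, hVY, Matrix.mul_zero, Matrix.mul_zero, sub_zero]
  have h3 : x₀ + toEuclideanLin V u + toEuclideanLin Y w - x₀ =
      toEuclideanLin V u + toEuclideanLin Y w := by abel
  rw [scaledError, h3, WithLp.ofLp_add, toLpLin_apply, toLpLin_apply, toLpLin_apply,
    mulVec_add, mulVec_mulVec, mulVec_mulVec, Matrix.mul_assoc, h1, Matrix.mul_assoc, h2,
    Matrix.mul_zero, zero_mulVec, zero_add]

/-- Lets the posterior scale, computed from the latent `v`, be read off the observed `Z`. -/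
theorem norm_toEuclideanLin_sqrt_mul {n p : ℕ} {A : Matrix (Fin n) (Fin n) ℝ} (hA : A.PosDef)
    {Y : Matrix (Fin n) (Fin p) ℝ} (hYA : Yᵀ * A * Y = 1) (w : EuclideanSpace ℝ (Fin p)) :
    ‖toEuclideanLin (CFC.sqrt A * Y) w‖ ^ 2 = ‖w‖ ^ 2 := by
  have hs : (CFC.sqrt A)ᵀ = CFC.sqrt A := by
    have : IsSelfAdjoint (CFC.sqrt A) := (CFC.sqrt_nonneg A).isSelfAdjoint
    rwa [IsSelfAdjoint, star_eq_conjTranspose, conjTranspose_eq_transpose_of_trivial] at this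
  have hss : CFC.sqrt A * CFC.sqrt A = A := CFC.sqrt_mul_sqrt_self A hA.posSemidef.nonneg
  rw [norm_sq_toEuclideanLin, transpose_mul, hs, Matrix.mul_assoc, ← Matrix.mul_assoc (CFC.sqrt A),
    hss, ← Matrix.mul_assoc, hYA, one_mulVec, EuclideanSpace.real_norm_sq_eq]
  simp only [dotProduct, sq]

theorem postScale_colMatrix {n k : ℕ} (β : ℝ) (z : Fin k → EuclideanSpace ℝ (Fin n)) :
    postScale β (colMatrix z) = β + (∑ i, ‖z i‖ ^ 2) / 2 := by
  simp only [EuclideanSpace.real_norm_sq_eq]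
  simp only [postScale, trace, diag, colMatrix, mul_apply, transpose_apply, of_apply, sq]

/-! ### The joint law of the scale, the solution and the observations -/

theorem projPrior_map_scaledError {n m p : ℕ} {A : Matrix (Fin n) (Fin n) ℝ}
    {V : Matrix (Fin n) (Fin m) ℝ} {Y : Matrix (Fin n) (Fin p) ℝ}
    (hG : IsUnit (Vᵀ * A * V).det) (hVY : Vᵀ * A * Y = 0) (x₀ : EuclideanSpace ℝ (Fin n))
    {t : ℝ} (ht : 0 < t) :
    (projPrior x₀ V Y (t • 1)).map (scaledError A V V x₀) =
      (stdGaussian (EuclideanSpace ℝ (Fin p))).map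
        fun w => toEuclideanLin (CFC.sqrt A * Y) (√t • w) := by
  have hm : Measurable (scaledError A V V x₀) := by
    have : scaledError A V V x₀ = fun x =>
      toEuclideanLin (CFC.sqrt A * errorProj A V V) (x - x₀) := rfl
    rw [this]
    fun_prop
  rw [projPrior_smul_one x₀ V Y ht, Measure.map_map hm (by fun_prop)]
  have h : (scaledError A V V x₀ ∘ fun q : EuclideanSpace ℝ (Fin m) × EuclideanSpace ℝ (Fin p) =>
      x₀ + toEuclideanLin V q.1 + toEuclideanLin Y (√t • q.2)) =
      (fun w => toEuclideanLin (CFC.sqrt A * Y) (√t • w)) ∘ Prod.snd :=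
    funext fun q => scaledError_add hG hVY x₀ _ _
  rw [h, ← Measure.map_map (by fun_prop) measurable_snd, ← Measure.snd, Measure.snd_prod]

/-- Reverses the order of sampling: first the latent observations `v` from their marginal law, then
the scale from its posterior, written as the updated scale times a variable `τ` of fixed law, then
the two normal components of `x`. Both parts of the theorem are read off this formula. -/
theorem lintegral_scale_solution_observations {Ω : Type*} [MeasurableSpace Ω] {P : Measure Ω}
    [IsProbabilityMeasure P] {n m p k : ℕ}
    {A : Matrix (Fin n) (Fin n) ℝ}
    {V : Matrix (Fin n) (Fin m) ℝ} {Y : Matrix (Fin n) (Fin p) ℝ}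
    (hG : IsUnit (Vᵀ * A * V).det) (hVY : Vᵀ * A * Y = 0)
    {x₀ : EuclideanSpace ℝ (Fin n)} {α β : ℝ} (hα : 0 < α) (hβ : 0 < β)
    {s : Ω → ℝ} {x : Ω → EuclideanSpace ℝ (Fin n)} {Z : Ω → Fin k → EuclideanSpace ℝ (Fin n)}
    (hs : AEMeasurable s P) (hx : AEMeasurable x P) (hZ : AEMeasurable Z P)
    (hs_law : P.map s = invGammaMeasure α β)
    (h_model : ∀ᵐ t ∂(P.map s), condDistrib (fun ω => (x ω, Z ω)) s P t =
      (projPrior x₀ V Y (t • 1)).prod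
        (Measure.pi fun _ : Fin k => (projPrior x₀ V Y (t • 1)).map (scaledError A V V x₀)))
    {F : ℝ × EuclideanSpace ℝ (Fin n) × (Fin k → EuclideanSpace ℝ (Fin n)) → ENNReal}
    (hF : Measurable F) :
    ∫⁻ ω, F (s ω, x ω, Z ω) ∂P =
      ∫⁻ v : Fin k → EuclideanSpace ℝ (Fin p),
        ∫⁻ τ, ∫⁻ q,
          F ((β + (∑ i, ‖v i‖ ^ 2) / 2) * τ,
            x₀ + toEuclideanLin V q.1 +
              toEuclideanLin Y (√((β + (∑ i, ‖v i‖ ^ 2) / 2) * τ) • q.2),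
            fun i => toEuclideanLin (CFC.sqrt A * Y) (v i))
          ∂((stdGaussian (EuclideanSpace ℝ (Fin m))).prod
            (stdGaussian (EuclideanSpace ℝ (Fin p))))
          ∂(invGammaMeasure (α + (k * p : ℕ) / 2) 1)
        ∂(volume.withDensity fun v =>
          ENNReal.ofReal (mixtureDensity (k * p) α β (∑ i, ‖v i‖ ^ 2))) := by
  set γ := (stdGaussian (EuclideanSpace ℝ (Fin m))).prod (stdGaussian (EuclideanSpace ℝ (Fin p)))
  set L := CFC.sqrt A * Y
  set G : ℝ → (Fin k → EuclideanSpace ℝ (Fin p)) → ENNReal := fun t v =>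
    ∫⁻ q, F (t, x₀ + toEuclideanLin V q.1 + toEuclideanLin Y (√t • q.2),
      fun i => toEuclideanLin L (v i)) ∂γ
  have hGm : Measurable (Function.uncurry G) := by
    refine Measurable.lintegral_prod_right' (f := fun r : (ℝ × (Fin k → EuclideanSpace ℝ (Fin p))) ×
      (EuclideanSpace ℝ (Fin m) × EuclideanSpace ℝ (Fin p)) =>
      F (r.1.1, x₀ + toEuclideanLin V r.2.1 + toEuclideanLin Y (√r.1.1 • r.2.2),
      fun i => toEuclideanLin L (r.1.2 i))) (hF.comp ?_)
    fun_prop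
  have hcond : ∀ᵐ t ∂(P.map s), ∫⁻ y, F (t, y) ∂(condDistrib (fun ω => (x ω, Z ω)) s P t) =
      ∫⁻ w, G t (√t • w) ∂(Measure.pi fun _ : Fin k => stdGaussian (EuclideanSpace ℝ (Fin p))) := by
    filter_upwards [h_model, hs_law ▸ ae_pos_invGammaMeasure α β] with t ht ht0
    have hLm : Measurable fun w : EuclideanSpace ℝ (Fin p) => toEuclideanLin L (√t • w) := by
      fun_prop
    have : IsProbabilityMeasure
        ((stdGaussian (EuclideanSpace ℝ (Fin p))).map fun w => toEuclideanLin L (√t • w)) :=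
      Measure.isProbabilityMeasure_map hLm.aemeasurable
    rw [ht, projPrior_map_scaledError hG hVY x₀ ht0, projPrior_smul_one x₀ V Y ht0,
      ← Measure.pi_map_pi (fun _ => hLm.aemeasurable),
      lintegral_prod_symm' (fun y => F (t, y)) (hF.comp measurable_prodMk_left),
      lintegral_map ?_ (by fun_prop)]
    · refine lintegral_congr fun w => ?_
      exact lintegral_map (f := fun y => F (t, y, fun i => toEuclideanLin L (√t • w i)))
        (hF.comp (by fun_prop)) (by fun_prop)
    · exact Measurable.lintegral_prod_left' (f := fun y => F (t, y))
        (hF.comp measurable_prodMk_left)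
  calc ∫⁻ ω, F (s ω, x ω, Z ω) ∂P
      = ∫⁻ t, ∫⁻ y, F (t, y) ∂(condDistrib (fun ω => (x ω, Z ω)) s P t) ∂(P.map s) := by
        rw [← Measure.lintegral_compProd hF, compProd_map_condDistrib (hx.prodMk hZ),
          lintegral_map' hF.aemeasurable (hs.prodMk (hx.prodMk hZ))]
    _ = ∫⁻ t, ∫⁻ w, G t (√t • w)
          ∂(Measure.pi fun _ : Fin k => stdGaussian (EuclideanSpace ℝ (Fin p)))
          ∂(invGammaMeasure α β) := by
        rw [lintegral_congr_ae hcond, hs_law]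
    _ = _ := by
        rw [lintegral_invGammaMeasure_gaussian volume (d := k * p)
          (by simp [Module.finrank_pi_fintype])
          (q := fun v : Fin k → EuclideanSpace ℝ (Fin p) => ∑ i, ‖v i‖ ^ 2) (by fun_prop)
          (fun v => by positivity)
          (fun c v => by simp [norm_smul, mul_pow, Finset.mul_sum])
          (pi_stdGaussian_eq_withDensity k p) hα hβ hGm]
        refine lintegral_congr fun v => ?_
        rw [invGammaMeasure_eq_map _ (by positivity),
          lintegral_map (f := fun t => G t v) (hGm.comp measurable_prodMk_right) (by fun_prop)]

/-! ### Posterior and predictive distributions -/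

theorem continuous_postScale_colMatrix {n k : ℕ} (β : ℝ) :
    Continuous fun z : Fin k → EuclideanSpace ℝ (Fin n) => postScale β (colMatrix z) := by
  simp_rw [postScale_colMatrix]
  fun_prop

theorem postScale_colMatrix_pos {n k : ℕ} {β : ℝ} (hβ : 0 < β)
    (z : Fin k → EuclideanSpace ℝ (Fin n)) : 0 < postScale β (colMatrix z) := by
  rw [postScale_colMatrix]
  positivity

theorem prod_invGammaMeasure_eq_map {T : Type*} [MeasurableSpace T] (γ : Measure T) [SFinite γ]
    (α : ℝ) {b : ℝ} (hb : 0 < b) [SFinite (invGammaMeasure α 1)] :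
    (invGammaMeasure α b).prod γ =
      ((invGammaMeasure α 1).prod γ).map (fun q => (b * q.1, q.2)) := by
  conv_lhs => rw [invGammaMeasure_eq_map α hb, ← Measure.map_id (μ := γ)]
  rw [Measure.map_prod_map _ _ (by fun_prop) measurable_id]
  rfl

theorem lemma8 {Ω : Type*} [MeasurableSpace Ω] (P : Measure Ω) [IsProbabilityMeasure P]
    {n m p k : ℕ}
    (A : Matrix (Fin n) (Fin n) ℝ) (hA : A.PosDef)
    (V W : Matrix (Fin n) (Fin m) ℝ) (hV : V.rank = m) (hWV : W = V)
    (Y : Matrix (Fin n) (Fin p) ℝ)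
    (hY : LinearMap.range Y.mulVecLin = LinearMap.ker (Wᵀ * A).mulVecLin)
    (hYA : Yᵀ * A * Y = 1)
    (x₀ : EuclideanSpace ℝ (Fin n))
    (α β : ℝ) (hα : 0 < α) (hβ : 0 < β)
    -- the scale, the unknown solution and the observations
    (s : Ω → ℝ) (x : Ω → EuclideanSpace ℝ (Fin n)) (Z : Ω → Fin k → EuclideanSpace ℝ (Fin n))
    (hs : AEMeasurable s P) (hx : AEMeasurable x P) (hZ : AEMeasurable Z P)
    (hs_law : P.map s = invGammaMeasure α β)
    -- given `s = t`, the variables `x, Z 0, …, Z (k - 1)` are independent, `x` is normal with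
    -- covariance `V Vᵀ + Y (t I) Yᵀ`, and each `Z i` is distributed as `A^{1/2} P₁ (x - x₀)`
    (h_model : ∀ᵐ t ∂(P.map s), condDistrib (fun ω => (x ω, Z ω)) s P t =
      (projPrior x₀ V Y (t • 1)).prod
        (Measure.pi fun _ : Fin k => (projPrior x₀ V Y (t • 1)).map (scaledError A V W x₀))) :
    -- the posterior distribution of `s` given `Z`
    IsContCondDistrib s Z P
      (fun z => invGammaMeasure (postShape α n m k) (postScale β (colMatrix z))) ∧
    -- the predictive distribution of `x` given `Wᵀ A x = Wᵀ b` and `Z = z`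
    ∃ κ : (Fin m → ℝ) × (Fin k → EuclideanSpace ℝ (Fin n)) → Measure (EuclideanSpace ℝ (Fin n)),
      IsContCondDistrib x (fun ω => ((Wᵀ * A) *ᵥ (x ω).ofLp, Z ω)) P κ ∧
      ∀ (b : EuclideanSpace ℝ (Fin n)) (z : Fin k → EuclideanSpace ℝ (Fin n)),
        κ (Wᵀ *ᵥ b.ofLp, z) =
          studentMeasure (2 * postShape α n m k) (projApprox A V W x₀ b)
            ((postScale β (colMatrix z) / postShape α n m k) • (Y * Yᵀ)) := by
  subst hWV
  have hG := isUnit_det_transpose_mul_mul hA (injective_mulVec_of_rank_eq hV)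
  have hVY : Wᵀ * A * Y = 0 := mul_eq_zero_of_range_eq_ker hY
  have hshape : postShape α n m k = α + (k * p : ℕ) / 2 := by
    rw [postShape, natCast_sub_eq_of_range_eq_ker hG hY hYA, Nat.cast_mul]
  set a := postShape α n m k
  have ha : 0 < a := by
    rw [hshape]
    positivity
  have hscale : ∀ v : Fin k → EuclideanSpace ℝ (Fin p), β + (∑ i, ‖v i‖ ^ 2) / 2 =
      postScale β (colMatrix fun i => toEuclideanLin (CFC.sqrt A * Y) (v i)) := fun v => by
    rw [postScale_colMatrix]
    simp_rw [norm_toEuclideanLin_sqrt_mul hA hYA]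
  have hjoint := fun {F} hF => lintegral_scale_solution_observations (F := F) hG hVY hα hβ
    hs hx hZ hs_law h_model hF
  simp_rw [hscale, ← hshape] at hjoint
  have hρ : IsProbabilityMeasure (invGammaMeasure a 1) :=
    isProbabilityMeasure_invGammaMeasure ha one_pos
  have hbc := continuous_postScale_colMatrix (n := n) (k := k) β
  have hbm := hbc.measurable
  refine ⟨?_, ?_⟩
  · have hH : Measurable (Function.uncurry fun (z : Fin k → EuclideanSpace ℝ (Fin n)) (τ : ℝ) =>
        postScale β (colMatrix z) * τ) := (hbm.comp measurable_fst).mul measurable_snd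
    refine isContCondDistrib_of_randomization hs hZ (invGammaMeasure a 1)
      (fun z τ => postScale β (colMatrix z) * τ) hH (fun τ => by fun_prop)
      (fun z => invGammaMeasure_eq_map a (postScale_colMatrix_pos hβ z)) fun F hF => ?_
    have hF' : Measurable fun z => ∫⁻ τ, F z (postScale β (colMatrix z) * τ)
        ∂(invGammaMeasure a 1) :=
      Measurable.lintegral_prod_right' (f := fun q : (Fin k → EuclideanSpace ℝ (Fin n)) × ℝ =>
        F q.1 (postScale β (colMatrix q.1) * q.2)) (hF.comp (measurable_fst.prodMk hH))
    -- The joint formula is applied to both sides. On the right the integrand depends on `Z` alone,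
    -- so the integrals over the original scale and solution are of mass one.
    rw [hjoint (F := fun r => F r.2.2 r.1)
        (hF.comp (measurable_snd.snd.prodMk measurable_fst)),
      hjoint (F := fun r => ∫⁻ τ, F r.2.2 (postScale β (colMatrix r.2.2) * τ)
        ∂(invGammaMeasure a 1)) (hF'.comp measurable_snd.snd)]
    simp only [lintegral_const, measure_univ, mul_one]
  · set γm := stdGaussian (EuclideanSpace ℝ (Fin m))
    set γp := stdGaussian (EuclideanSpace ℝ (Fin p))
    set ρ := (invGammaMeasure a 1).prod γp
    -- The centre `x̃` as a function of the observed value `c = Wᵀ b`.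
    set g : (Fin m → ℝ) → EuclideanSpace ℝ (Fin n) := fun c =>
      x₀ + toEuclideanLin (W * (Wᵀ * A * W)⁻¹) (WithLp.toLp 2 (c - (Wᵀ * A) *ᵥ x₀.ofLp)) with hg
    have hgc : Continuous g := by fun_prop
    set H : (Fin m → ℝ) × (Fin k → EuclideanSpace ℝ (Fin n)) → ℝ × EuclideanSpace ℝ (Fin p) →
        EuclideanSpace ℝ (Fin n) := fun c q =>
      g c.1 + toEuclideanLin Y (√(postScale β (colMatrix c.2) * q.1) • q.2) with hHdef
    have hH : Measurable (Function.uncurry H) := by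
      have h1 : Measurable fun r : ((Fin m → ℝ) × (Fin k → EuclideanSpace ℝ (Fin n))) ×
          (ℝ × EuclideanSpace ℝ (Fin p)) => g r.1.1 :=
        hgc.measurable.comp (measurable_fst.comp measurable_fst)
      have h2 : Measurable fun r : ((Fin m → ℝ) × (Fin k → EuclideanSpace ℝ (Fin n))) ×
          (ℝ × EuclideanSpace ℝ (Fin p)) => postScale β (colMatrix r.1.2) :=
        hbm.comp (measurable_snd.comp measurable_fst)
      exact h1.add (((h2.mul (measurable_fst.comp measurable_snd)).sqrt.smul
        (measurable_snd.comp measurable_snd)).toEuclideanLin Y)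
    have hHc : ∀ q, Continuous fun c => H c q := fun q =>
      (hgc.comp continuous_fst).add
        ((((hbc.comp continuous_snd).mul_const q.1).sqrt.smul continuous_const).toEuclideanLin Y)
    have hobs : ∀ (u : EuclideanSpace ℝ (Fin m)) (w : EuclideanSpace ℝ (Fin p)),
        (Wᵀ * A) *ᵥ (x₀ + toEuclideanLin W u + toEuclideanLin Y w).ofLp =
          (Wᵀ * A) *ᵥ x₀.ofLp + (Wᵀ * A * W) *ᵥ u.ofLp := by
      intro u w
      rw [WithLp.ofLp_add, WithLp.ofLp_add, toLpLin_apply, toLpLin_apply, mulVec_add, mulVec_add,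
        mulVec_mulVec, mulVec_mulVec, hVY, zero_mulVec, add_zero]
    -- The observation determines the component of `x` along the columns of `W`, which is now also
    -- `V`.
    have hgobs : ∀ u : EuclideanSpace ℝ (Fin m),
        g ((Wᵀ * A) *ᵥ x₀.ofLp + (Wᵀ * A * W) *ᵥ u.ofLp) = x₀ + toEuclideanLin W u := by
      intro u
      simp only [hg]
      rw [add_sub_cancel_left, toLpLin_apply, toLpLin_apply, mulVec_mulVec, Matrix.mul_assoc,
        nonsing_inv_mul _ hG, Matrix.mul_one]
    refine ⟨fun c => ρ.map (H c), ?_, fun b z => ?_⟩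
    · have hobsm : AEMeasurable (fun ω => ((Wᵀ * A) *ᵥ (x ω).ofLp, Z ω)) P := by
        have : Continuous fun y : EuclideanSpace ℝ (Fin n) => (Wᵀ * A) *ᵥ y.ofLp := by fun_prop
        exact (this.measurable.comp_aemeasurable hx).prodMk hZ
      refine isContCondDistrib_of_randomization hx hobsm ρ H hH hHc
        (fun c => rfl) fun F hF => ?_
      have hAm : Measurable fun y : EuclideanSpace ℝ (Fin n) => (Wᵀ * A) *ᵥ y.ofLp :=
        (by fun_prop : Continuous _).measurable
      have hFH : Measurable fun r : ((Fin m → ℝ) × (Fin k → EuclideanSpace ℝ (Fin n))) ×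
          (ℝ × EuclideanSpace ℝ (Fin p)) => F r.1 (H r.1 r.2) :=
        hF.comp (measurable_fst.prodMk hH)
      have hF' : Measurable fun c => ∫⁻ q, F c (H c q) ∂ρ := hFH.lintegral_prod_right'
      rw [hjoint (F := fun r => F ((Wᵀ * A) *ᵥ r.2.1.ofLp, r.2.2) r.2.1)
          (hF.comp (((hAm.comp measurable_snd.fst).prodMk measurable_snd.snd).prodMk
            measurable_snd.fst)),
        hjoint (F := fun r => ∫⁻ q, F ((Wᵀ * A) *ᵥ r.2.1.ofLp, r.2.2)
          (H ((Wᵀ * A) *ᵥ r.2.1.ofLp, r.2.2) q) ∂ρ) (hF'.comp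
            ((hAm.comp measurable_snd.fst).prodMk measurable_snd.snd))]
      refine lintegral_congr fun v => ?_
      set z : Fin k → EuclideanSpace ℝ (Fin n) := fun i => toEuclideanLin (CFC.sqrt A * Y) (v i)
      simp only [hobs]
      set c : EuclideanSpace ℝ (Fin m) → (Fin m → ℝ) × (Fin k → EuclideanSpace ℝ (Fin n)) :=
        fun u => ((Wᵀ * A) *ᵥ x₀.ofLp + (Wᵀ * A * W) *ᵥ u.ofLp, z) with hcdef
      have hcm : Measurable c := (by fun_prop : Continuous c).measurable
      have hcH : ∀ u τ w, x₀ + toEuclideanLin W u +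
          toEuclideanLin Y (√(postScale β (colMatrix z) * τ) • w) = H (c u) (τ, w) := by
        intro u τ w
        simp only [hHdef, hcdef, hgobs]
      have hFm : Measurable fun r : (ℝ × EuclideanSpace ℝ (Fin m)) × EuclideanSpace ℝ (Fin p) =>
          F (c r.1.2) (H (c r.1.2) (r.1.1, r.2)) := by
        exact hFH.comp (by fun_prop : Measurable fun r :
          (ℝ × EuclideanSpace ℝ (Fin m)) × EuclideanSpace ℝ (Fin p) => (c r.1.2, (r.1.1, r.2)))
      -- With `v` fixed, `u` carries the observed value and is moved outside, while `(τ, w)` becomes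
      -- the randomization. The variables `τ` and `w` of the right-hand side do not enter its
      -- integrand.
      calc _ = ∫⁻ τ, ∫⁻ u, ∫⁻ w, F (c u) (H (c u) (τ, w)) ∂γp ∂γm ∂(invGammaMeasure a 1) := by
            refine lintegral_congr fun τ => ?_
            simp only [hcH]
            exact lintegral_prod _ (hFm.comp (by fun_prop : Measurable fun q :
              EuclideanSpace ℝ (Fin m) × EuclideanSpace ℝ (Fin p) =>
                ((τ, q.1), q.2))).aemeasurable
        _ = ∫⁻ u, ∫⁻ τ, ∫⁻ w, F (c u) (H (c u) (τ, w)) ∂γp ∂(invGammaMeasure a 1) ∂γm :=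
            lintegral_lintegral_swap hFm.lintegral_prod_right'.aemeasurable
        _ = ∫⁻ u, ∫⁻ q, F (c u) (H (c u) q) ∂ρ ∂γm := by
            refine lintegral_congr fun u => ?_
            exact (lintegral_prod (fun q => F (c u) (H (c u) q))
              (hFH.comp measurable_prodMk_left).aemeasurable).symm
        _ = ∫⁻ q, ∫⁻ q', F (c q.1) (H (c q.1) q') ∂ρ ∂(γm.prod γp) := by
            rw [lintegral_prod (fun q => ∫⁻ q', F (c q.1) (H (c q.1) q') ∂ρ)
              (hF'.comp (hcm.comp measurable_fst)).aemeasurable]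
            simp only [lintegral_const, measure_univ, mul_one]
        _ = _ := by
            simp only [lintegral_const, measure_univ, mul_one]
            rfl
    · have hb := postScale_colMatrix_pos hβ z
      have hD := det_transpose_mul_self_pos hYA
      have hgb : g (Wᵀ *ᵥ b.ofLp) = projApprox A W W x₀ b := by
        simp only [hg, projApprox]
        rw [toLpLin_apply, ← mulVec_mulVec (M := Wᵀ), ← mulVec_sub, WithLp.ofLp_toLp, mulVec_mulVec]
      rw [studentMeasure_eq_map _ hD ha hb, prod_invGammaMeasure_eq_map _ a hb,
        Measure.map_map (by fun_prop) (by fun_prop), ← hgb]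
      rfl
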